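/- Let $\mathcal V=(\mathcal V_o,\otimes,e)$ be a commutative quantale: a complete lattice with a commutative, associative, unital multiplication $\otimes$ (unit $e$) that preserves arbitrary joins in each variable. Assume that $\mathcal V$ is non-trivial and integral, i.e. $e=\top$. Let $\mathcal V\text{-}\mathsf{cat}$ be the category of small $\mathcal V$-categories and $\mathcal V$-functors, enriched over itself by $[\mathcal X,\mathcal Y](f,g)=\bigwedge_{x}\mathcal Y(fx,gx)$; let $\mathsf{Set}$ be enriched in $\mathcal V\text{-}\mathsf{cat}$ with discrete hom-$\mathcal V$-categories (self-distances $e$, all other distances $\bot$), and let $D:\mathsf{Set}\to\mathcal V\text{-}\mathsf{cat}$ be the $\mathcal V\text{-}\mathsf{cat}$-functor sending a set $X$ to the discrete $\mathcal V$-category on $X$. Let $\mathbb N$ be the free $\mathcal V\text{-}\mathsf{cat}$-category on the ordinary category with objects the elements $r$ of $\mathcal V_o$ and one further object $\mathsf o$, whose non-identity arrows are $\delta^r_0,\delta^r_1:r\to\mathsf o$ for each $r$. Let $N:\mathbb N^{op}\to\mathcal V\text{-}\mathsf{cat}$ be the weight with $N\mathsf o=\mathbb 1$ (one object $0$, $\mathbb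 1(0,0)=e$), $Nr=\mathbb 2_r$ (two objects $0,1$ with $\mathbb 2_r(0,0)=\mathbb 2_r(1,1)=e$, $\mathbb 2_r(0,1)=r$, $\mathbb 2_r(1,0)=\bot$) and with $N\delta^r_i:\mathbb 1\to\mathbb 2_r$ picking the object $i$. For a small $\mathcal V$-category $\mathcal X$ let $F_{\mathcal X}:\mathbb N\to\mathsf{Set}$ send $\mathsf o$ to the set $X_{\mathsf o}$ of objects of $\mathcal X$, $r$ to $X_r=\{(x',x)\mid r\le\mathcal X(x',x)\}$, and $\delta_0^r,\delta_1^r$ to the first and second projection. A colimit weighted by $N$ is called a $\mathcal V$-coinserter. Then: 1. $D$ is dense, i.e. the $\mathcal V\text{-}\mathsf{cat}$-functor $\mathcal X\mapsto\mathcal V\text{-}\mathsf{cat}(D-,\mathcal X)$ from $\mathcal V\text{-}\mathsf{cat}$ to $[\mathsf{Set}^{op},\mathcal V\text{-}\mathsf{cat}]$ is fully faithful. 2. The family of diagrams $(N,DF_{\mathcal X})$, with $\mathcal X$ ranging over all small $\mathcal V$-categories, is a density presentation of $D$ in the sense of Kelly: $D$ is fully faithful as a $\mathcal V\text{-}\mathsf{cat}$-functor;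 each weighted colimit $N*DF_{\mathcal X}$ exists in $\mathcal V\text{-}\mathsf{cat}$; each of them is preserved by $\mathcal V\text{-}\mathsf{cat}(DS,-):\mathcal V\text{-}\mathsf{cat}\to\mathcal V\text{-}\mathsf{cat}$ for every set $S$; and $\mathcal V\text{-}\mathsf{cat}$ is the closure of $\mathsf{Set}$ under these colimits, i.e. the only full replete subcategory of $\mathcal V\text{-}\mathsf{cat}$ that contains all $DS$ and contains the colimit of each diagram of the family that lies in it is $\mathcal V\text{-}\mathsf{cat}$ itself. 3. For each small $\mathcal V$-category $\mathcal X$, the diagram $(N,DF_{\mathcal X})$ exhibits $\mathcal X$ as a $\mathcal V$-coinserter of discrete $\mathcal V$-categories: $\mathcal X\cong N*DF_{\mathcal X}$, by a colimit cocone $N\to\mathcal V\text{-}\mathsf{cat}(DF_{\mathcal X}-,\mathcal X)$ whose component at $\mathsf o$ picks the identity-on-objects $\mathcal V$-functor $q:DX_{\mathsf o}\to\mathcal X$. -/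

import Mathlib

open CategoryTheory Opposite

universe u v w v₁ u₁ v₂ u₂ v₃ u₃

/-! ## `V`-categories over a commutative quantale

A commutative quantale is a commutative monoid `(V, *, 1)` which is also a complete lattice, such
that multiplication preserves arbitrary suprema in each variable (`IsQuantale V`). -/

/-- A `V`-category structure on the type of objects `X`. -/
class VCategory (V : Type u) [CommMonoid V] [CompleteLattice V] (X : Type v) where
  /-- the hom-object ("distance") `X(x', x)` -/
  vhom : X → X → V
  one_le_vhom : ∀ x, 1 ≤ vhom x x
  vhom_mul_vhom_le : ∀ x'' x' x, vhom x' x * vhom x'' x' ≤ vhom x'' x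

/-- The hom-object `X(x', x)` of a `V`-category. -/
def vhom (V : Type u) [CommMonoid V] [CompleteLattice V] {X : Type v} [VCategory V X]
    (x' x : X) : V :=
  VCategory.vhom x' x

/-- A `V`-functor. -/
@[ext]
structure VFunctor (V : Type u) [CommMonoid V] [CompleteLattice V]
    (X : Type v) [VCategory V X] (Y : Type w) [VCategory V Y] where
  toFun : X → Y
  vhom_le : ∀ x' x, vhom V x' x ≤ vhom V (toFun x') (toFun x)

/-- A function between (objects of) `V`-categories is an isomorphism of `V`-categories. -/
def IsVIso (V : Type u) [CommMonoid V] [CompleteLattice V] {X : Type v} [VCategory V X]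
    {Y : Type w} [VCategory V Y] (f : X → Y) : Prop :=
  Function.Bijective f ∧ ∀ x' x, vhom V (f x') (f x) = vhom V x' x

/-- Small `V`-categories. -/
structure VCat (V : Type u) [CommMonoid V] [CompleteLattice V] where
  carrier : Type u
  [str : VCategory V carrier]

namespace VCat

variable {V : Type u} [CommMonoid V] [CompleteLattice V]

instance : CoeSort (VCat V) (Type u) := ⟨VCat.carrier⟩

attribute [instance] VCat.str

/-- The ordinary category of small `V`-categories and `V`-functors. -/
instance : Category.{u} (VCat V) where
  Hom X Y := VFunctor V X Y
  id X := ⟨fun x => x, fun _ _ => le_rfl⟩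
  comp f g := ⟨fun x => g.toFun (f.toFun x), fun x' x =>
    (f.vhom_le x' x).trans (g.vhom_le _ _)⟩

/-- The action of a `V`-functor on objects. -/
def app {X Y : VCat V} (f : X ⟶ Y) : X → Y := VFunctor.toFun f

end VCat

/-! ## Categories enriched in `V-cat` -/

/-- A `V-cat`-category: an ordinary category whose hom-sets are the sets of objects of
`V`-categories, such that composition is a `V`-functor `C(Y,Z) ⊗ C(X,Y) ⟶ C(X,Z)`.
(That the identities are `V`-functors out of the unit `V`-category is automatic.) -/
class VCatEnriched (V : Type u) [CommMonoid V] [CompleteLattice V] (C : Type u₁)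
    [Category.{v₁} C] where
  homV : ∀ X Y : C, VCategory V (X ⟶ Y)
  comp_le : ∀ {X Y Z : C} (f f' : X ⟶ Y) (g g' : Y ⟶ Z),
    vhom V g g' * vhom V f f' ≤ vhom V (f ≫ g) (f' ≫ g')

attribute [reducible] VCatEnriched.homV

attribute [instance] VCatEnriched.homV

/-- A `V-cat`-functor. -/
structure VCatFunctor (V : Type u) [CommMonoid V] [CompleteLattice V]
    (A : Type u₁) [Category.{v₁} A] [VCatEnriched V A]
    (B : Type u₂) [Category.{v₂} B] [VCatEnriched V B] extends A ⥤ B where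
  vhom_map_le : ∀ {X Y : A} (f g : X ⟶ Y),
    vhom V f g ≤ vhom V (toFunctor.map f) (toFunctor.map g)

namespace VCatFunctor

variable {V : Type u} [CommMonoid V] [CompleteLattice V]
  {A : Type u₁} [Category.{v₁} A] [VCatEnriched V A]
  {B : Type u₂} [Category.{v₂} B] [VCatEnriched V B]
  {C : Type u₃} [Category.{v₃} C] [VCatEnriched V C]

/-- Composition of `V-cat`-functors (in diagrammatic order). -/
def comp (F : VCatFunctor V A B) (G : VCatFunctor V B C) : VCatFunctor V A C where
  toFunctor := F.toFunctor ⋙ G.toFunctor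
  vhom_map_le f g := (F.vhom_map_le f g).trans (G.vhom_map_le _ _)

/-- A `V-cat`-functor is fully faithful if its actions on hom-`V`-categories are isomorphisms
of `V`-categories. -/
def FullyFaithful (F : VCatFunctor V A B) : Prop :=
  ∀ X Y : A, IsVIso V (fun f : X ⟶ Y => F.map f)

/-- `V-cat`-functors and `V-cat`-natural transformations. Since `V` is a poset, the latter are
the natural transformations between the underlying functors. -/
instance : Category (VCatFunctor V A B) where
  Hom F G := NatTrans F.toFunctor G.toFunctor
  id F := NatTrans.id F.toFunctor
  comp α β := NatTrans.vcomp α β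

end VCatFunctor

section Enrichments

variable {V : Type u} [CommMonoid V] [CompleteLattice V]

/-- The opposite of a `V-cat`-category. -/
instance VCatEnriched.opposite (A : Type u₁) [Category.{v₁} A] [VCatEnriched V A] :
    VCatEnriched V Aᵒᵖ where
  homV X Y :=
    { vhom := fun f g => vhom V f.unop g.unop
      one_le_vhom := fun f => VCategory.one_le_vhom f.unop
      vhom_mul_vhom_le := fun f g h => VCategory.vhom_mul_vhom_le f.unop g.unop h.unop }
  comp_le f f' g g' := by
    rw [mul_comm]
    exact VCatEnriched.comp_le g.unop g'.unop f.unop f'.unop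

variable [IsQuantale V]

/-- A pointwise meet of `V`-categories: the end computing the hom of a functor category. -/
theorem iInf_vhom_mul_le {ι : Sort v} {X : ι → Type w} [∀ i, VCategory V (X i)]
    (f g h : ∀ i, X i) :
    (⨅ i, vhom V (g i) (h i)) * (⨅ i, vhom V (f i) (g i)) ≤ ⨅ i, vhom V (f i) (h i) :=
  le_iInf fun i => (mul_le_mul' (iInf_le _ i) (iInf_le _ i)).trans
    (VCategory.vhom_mul_vhom_le (f i) (g i) (h i))

/-- `V-cat` as a `V-cat`-category: `V-cat(X, Y)(f, g) = ⨅ x, Y(f x, g x)`. -/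
instance VCat.enriched : VCatEnriched V (VCat V) where
  homV X Y :=
    { vhom := fun f g => ⨅ x : X, vhom V (VFunctor.toFun f x) (VFunctor.toFun g x)
      one_le_vhom := fun f => le_iInf fun x => VCategory.one_le_vhom (VFunctor.toFun f x)
      vhom_mul_vhom_le := fun f g h =>
        iInf_vhom_mul_le (VFunctor.toFun f) (VFunctor.toFun g) (VFunctor.toFun h) }
  comp_le {X Y Z} f f' g g' := by
    refine le_iInf fun x : X => ?_
    refine le_trans ?_ (VCategory.vhom_mul_vhom_le (V := V)
      (VFunctor.toFun g (VFunctor.toFun f x)) (VFunctor.toFun g (VFunctor.toFun f' x))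
      (VFunctor.toFun g' (VFunctor.toFun f' x)))
    exact mul_le_mul' (iInf_le _ (VFunctor.toFun f' x))
      ((iInf_le _ x).trans (VFunctor.vhom_le g _ _))

/-- The functor `V-cat`-category `[A, B]`: the distance of two transformations is the meet of the
distances of their components. -/
instance VCatFunctor.enriched {A : Type u₁} [Category.{v₁} A] [VCatEnriched V A]
    {B : Type u₂} [Category.{v₂} B] [VCatEnriched V B] :
    VCatEnriched V (VCatFunctor V A B) where
  homV _ _ :=
    { vhom := fun α β => ⨅ a : A, vhom V (NatTrans.app α a) (NatTrans.app β a)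
      one_le_vhom := fun α => le_iInf fun a => VCategory.one_le_vhom (NatTrans.app α a)
      vhom_mul_vhom_le := fun α β γ =>
        iInf_vhom_mul_le (NatTrans.app α) (NatTrans.app β) (NatTrans.app γ) }
  comp_le α α' β β' := le_iInf fun a => (mul_le_mul' (iInf_le _ a) (iInf_le _ a)).trans
    (VCatEnriched.comp_le (NatTrans.app α a) (NatTrans.app α' a)
      (NatTrans.app β a) (NatTrans.app β' a))

open scoped Classical in
/-- The discrete `V`-category on a type: self-distances `1`, all other distances `⊥`. -/
@[reducible]
noncomputable def discreteVCategory (V : Type u) [CommMonoid V] [CompleteLattice V] [IsQuantale V]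
    (X : Type v) : VCategory V X where
  vhom x' x := if x' = x then 1 else ⊥
  one_le_vhom x := by simp
  vhom_mul_vhom_le x'' x' x := by
    by_cases h : x' = x
    · subst h; simp
    · simp [h]

/-- The free `V-cat`-category on an ordinary category `A`: its hom-`V`-categories are the discrete
ones on the hom-sets of `A`. -/
@[reducible]
noncomputable def freeEnriched (V : Type u) [CommMonoid V] [CompleteLattice V] [IsQuantale V]
    (A : Type u₁) [Category.{v₁} A] : VCatEnriched V A where
  homV X Y := discreteVCategory V (X ⟶ Y)
  comp_le {X Y Z} f f' g g' := by
    classical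
    change (if g = g' then (1 : V) else ⊥) * (if f = f' then (1 : V) else ⊥) ≤
      (if f ≫ g = f' ≫ g' then (1 : V) else ⊥)
    by_cases hg : g = g'
    · by_cases hf : f = f'
      · subst hg hf; simp
      · simp [hf]
    · simp [hg]

/-- An ordinary functor out of `A` is a `V-cat`-functor out of the free `V-cat`-category on `A`. -/
noncomputable def VCatFunctor.ofFree {A : Type u₁} [Category.{v₁} A]
    {B : Type u₂} [Category.{v₂} B] [VCatEnriched V B] (F : A ⥤ B) :
    letI := freeEnriched V A
    VCatFunctor V A B :=
  letI := freeEnriched V A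
  { toFunctor := F
    vhom_map_le := fun {X Y} f g => by
      classical
      change (if f = g then (1 : V) else ⊥) ≤ _
      by_cases h : f = g
      · subst h
        rw [if_pos rfl]
        exact VCategory.one_le_vhom (V := V) (F.map f)
      · simp [h] }

end Enrichments

/-! ## Weighted colimits and density -/

section Colimits

variable {V : Type u} [CommMonoid V] [CompleteLattice V] [IsQuantale V]
  {A : Type u₁} [Category.{v₁} A] [VCatEnriched V A]
  {C : Type u₂} [Category.{u} C] [VCatEnriched V C]
  {B : Type u₃} [Category.{u} B] [VCatEnriched V B]

theorem vhom_comp_right_le {X Y Z : C} (f f' : X ⟶ Y) (g : Y ⟶ Z) :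
    vhom V f f' ≤ vhom V (f ≫ g) (f' ≫ g) := by
  refine le_trans ?_ (VCatEnriched.comp_le f f' g g)
  calc vhom V f f' = 1 * vhom V f f' := (one_mul _).symm
    _ ≤ _ := mul_le_mul' (VCategory.one_le_vhom g) le_rfl

theorem vhom_comp_left_le {X Y Z : C} (f : X ⟶ Y) (g g' : Y ⟶ Z) :
    vhom V g g' ≤ vhom V (f ≫ g) (f ≫ g') := by
  refine le_trans ?_ (VCatEnriched.comp_le f f g g')
  calc vhom V g g' = vhom V g g' * 1 := (mul_one _).symm
    _ ≤ _ := mul_le_mul' le_rfl (VCategory.one_le_vhom f)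

/-- The hom-`V`-category `C(X, Y)`, as an object of `V-cat`. -/
def homObj (V : Type u) [CommMonoid V] [CompleteLattice V] {C : Type u₂} [Category.{u} C]
    [VCatEnriched V C] (X Y : C) : VCat V :=
  ⟨X ⟶ Y⟩

/-- The covariant representable `V-cat`-functor `C(X, -)`. -/
def covariantHom (V : Type u) [CommMonoid V] [CompleteLattice V] [IsQuantale V]
    {C : Type u₂} [Category.{u} C] [VCatEnriched V C] (X : C) : VCatFunctor V C (VCat V) where
  obj Y := homObj V X Y
  map g := (⟨fun f : X ⟶ _ => f ≫ g, fun f f' => vhom_comp_right_le f f' g⟩ : VFunctor V _ _)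
  map_id _ := VFunctor.ext (funext fun f => Category.comp_id f)
  map_comp g h := VFunctor.ext (funext fun f => (Category.assoc f g h).symm)
  vhom_map_le g g' := le_iInf fun f => vhom_comp_left_le f g g'

/-- The presheaf `C(K-, X) : Aᵒᵖ ⟶ V-cat`. -/
def relHomObj (K : VCatFunctor V A C) (X : C) : VCatFunctor V Aᵒᵖ (VCat V) where
  obj a := homObj V (K.obj a.unop) X
  map p := (⟨fun f : K.obj _ ⟶ X => K.map p.unop ≫ f,
    fun f f' => vhom_comp_left_le _ f f'⟩ : VFunctor V _ _)
  map_id a := VFunctor.ext (funext fun f => by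
    change K.map (𝟙 a.unop) ≫ f = f
    rw [K.map_id, Category.id_comp])
  map_comp p q := VFunctor.ext (funext fun f => by
    change K.map (q.unop ≫ p.unop) ≫ f = K.map q.unop ≫ K.map p.unop ≫ f
    rw [K.map_comp, Category.assoc])
  vhom_map_le p q := le_iInf fun f => le_trans (K.vhom_map_le p.unop q.unop)
    (vhom_comp_right_le (K.map p.unop) (K.map q.unop) f)

/-- The `V-cat`-functor `C ⟶ [Aᵒᵖ, V-cat]`, `X ↦ C(K-, X)`, induced by `K : A ⟶ C`. -/
def relHom (K : VCatFunctor V A C) : VCatFunctor V C (VCatFunctor V Aᵒᵖ (VCat V)) where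
  obj X := relHomObj K X
  map g :=
    { app := fun a => (covariantHom V (K.obj a.unop)).map g
      naturality := fun _ _ p => VFunctor.ext (funext fun f =>
        Category.assoc (K.map p.unop) f g) }
  map_id X := NatTrans.ext (funext fun a => (covariantHom V (K.obj a.unop)).map_id X)
  map_comp g h := NatTrans.ext (funext fun a => (covariantHom V (K.obj a.unop)).map_comp g h)
  vhom_map_le g g' := le_iInf fun a => (covariantHom V (K.obj a.unop)).vhom_map_le g g'

/-- `K : A ⟶ C` is dense if `C ⟶ [Aᵒᵖ, V-cat]`, `X ↦ C(K-, X)`, is fully faithful. -/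
def IsDense (K : VCatFunctor V A C) : Prop := (relHom K).FullyFaithful

/-- The transformation `μ : W ⟶ C(F-, X)` exhibits `X` as the colimit of `F` weighted by `W`:
composition with `μ` is an isomorphism of `V`-categories
`C(X, Y) ≅ [Aᵒᵖ, V-cat](W, C(F-, Y))` for all `Y`.
By Yoneda, each isomorphism `V-cat`-natural in `Y` is of this form for a unique `μ`. -/
def IsWeightedColimit (W : VCatFunctor V Aᵒᵖ (VCat V)) (F : VCatFunctor V A C) {X : C}
    (μ : W ⟶ (relHom F).obj X) : Prop :=
  ∀ Y : C, IsVIso V (fun g : X ⟶ Y => μ ≫ (relHom F).map g)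

/-- The action of `G : C ⟶ B` on hom-objects, as a transformation
`C(F-, X) ⟶ B(GF-, GX)`. -/
def relHomMap (F : VCatFunctor V A C) (G : VCatFunctor V C B) (X : C) :
    (relHom F).obj X ⟶ (relHom (F.comp G)).obj (G.obj X) where
  app a := (⟨fun f : F.obj a.unop ⟶ X => G.map f, fun f f' => G.vhom_map_le f f'⟩ :
    VFunctor V (F.obj a.unop ⟶ X) (G.obj (F.obj a.unop) ⟶ G.obj X))
  naturality _ _ p := VFunctor.ext (funext fun f => G.map_comp (F.map p.unop) f)

/-- `G` preserves the colimit with unit `μ`. -/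
def PreservesWeightedColimit (W : VCatFunctor V Aᵒᵖ (VCat V)) (F : VCatFunctor V A C) {X : C}
    (μ : W ⟶ (relHom F).obj X) (G : VCatFunctor V C B) : Prop :=
  IsWeightedColimit W (F.comp G) (μ ≫ relHomMap F G X)

/-- A small diagram in `C`, with a weight: a pair `(W : Lᵒᵖ ⟶ V-cat, P : L ⟶ C)`, `L` small. -/
structure WeightedDiagram (V : Type u) [CommMonoid V] [CompleteLattice V] [IsQuantale V]
    (C : Type u₂) [Category.{u} C] [VCatEnriched V C] where
  L : Type u
  [cat : Category.{u} L]
  [enriched : VCatEnriched V L]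
  weight : VCatFunctor V Lᵒᵖ (VCat V)
  diag : VCatFunctor V L C

attribute [instance] WeightedDiagram.cat WeightedDiagram.enriched

/-- The (object class of the) closure of `A` in `C` under the colimits of a family of diagrams: the
smallest replete full subcategory of `C` which contains the objects `K a` and which contains the
colimit of each diagram of the family that lies in it. -/
inductive ColimitClosure (K : VCatFunctor V A C) {Γ : Type w} (Φ : Γ → WeightedDiagram V C) :
    C → Prop
  | of (a : A) : ColimitClosure K Φ (K.obj a)
  | iso {X Y : C} (i : X ≅ Y) (hX : ColimitClosure K Φ X) : ColimitClosure K Φ Y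
  | colim (γ : Γ) {X : C} (μ : (Φ γ).weight ⟶ (relHom (Φ γ).diag).obj X)
      (hμ : IsWeightedColimit (Φ γ).weight (Φ γ).diag μ)
      (h : ∀ l : (Φ γ).L, ColimitClosure K Φ ((Φ γ).diag.obj l)) : ColimitClosure K Φ X

/-- A family `Φ` of diagrams in `C` is a density presentation of `K : A ⟶ C` (in the sense of
Kelly) if `K` is fully faithful, the colimits of the diagrams exist in `C` and are preserved by all
`C(K a, -)`, and `C` is the closure of `A` under these colimits. -/
structure IsDensityPresentation (K : VCatFunctor V A C) {Γ : Type w}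
    (Φ : Γ → WeightedDiagram V C) : Prop where
  fullyFaithful : K.FullyFaithful
  exists_colimit : ∀ γ, ∃ (X : C) (μ : (Φ γ).weight ⟶ (relHom (Φ γ).diag).obj X),
    IsWeightedColimit (Φ γ).weight (Φ γ).diag μ
  preserves : ∀ (γ : Γ) (X : C) (μ : (Φ γ).weight ⟶ (relHom (Φ γ).diag).obj X),
    IsWeightedColimit (Φ γ).weight (Φ γ).diag μ →
      ∀ a : A, PreservesWeightedColimit (Φ γ).weight (Φ γ).diag μ (covariantHom V (K.obj a))
  closure : ∀ X : C, ColimitClosure K Φ X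

end Colimits

/-! ## The discrete functor and `V`-coinserters -/

section Discrete

variable (V : Type u) [CommMonoid V] [CompleteLattice V] [IsQuantale V]

/-- `Set` as a `V-cat`-category, with discrete hom-`V`-categories. -/
noncomputable instance setEnriched : VCatEnriched V (Type u) := freeEnriched V (Type u)

/-- The ordinary discrete functor `Set ⥤ V-cat`. -/
noncomputable def discreteFunctorOrd : Type u ⥤ VCat V where
  obj S := letI := discreteVCategory V S; ⟨S⟩
  map {S T} f :=
    letI := discreteVCategory V S
    letI := discreteVCategory V T
    (⟨fun s : S => f s, fun s' s => by
      classical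
      change (if s' = s then (1 : V) else ⊥) ≤ (if f s' = f s then (1 : V) else ⊥)
      by_cases h : s' = s
      · subst h; simp
      · simp [h]⟩ : VFunctor V S T)
  map_id S := rfl
  map_comp f g := rfl

/-- The discrete functor `D : Set ⟶ V-cat`, as a `V-cat`-functor. -/
noncomputable def discreteFunctor : VCatFunctor V (Type u) (VCat V) :=
  VCatFunctor.ofFree (discreteFunctorOrd V)

/-- The objects of the indexing category of `V`-coinserters: the elements of `V`, and one more
object `o`. -/
inductive NIndex : Type u
  | o : NIndex
  | el (r : V) : NIndex

variable {V}

/-- The arrows of the indexing category: besides identities, two arrows `δ₀ r`, `δ₁ r` from `r`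
to `o`, for each `r` in `V`. -/
inductive NIndex.Hom : NIndex V → NIndex V → Type u
  | id (a : NIndex V) : NIndex.Hom a a
  | δ₀ (r : V) : NIndex.Hom (.el r) .o
  | δ₁ (r : V) : NIndex.Hom (.el r) .o

/-- Composition in the indexing category. -/
def NIndex.Hom.comp : {a b c : NIndex V} → NIndex.Hom a b → NIndex.Hom b c → NIndex.Hom a c
  | _, _, _, .id _, g => g
  | _, _, _, .δ₀ r, .id _ => .δ₀ r
  | _, _, _, .δ₁ r, .id _ => .δ₁ r

instance : Category.{u} (NIndex V) where
  Hom := NIndex.Hom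
  id := NIndex.Hom.id
  comp := NIndex.Hom.comp
  id_comp f := rfl
  comp_id f := by cases f <;> rfl
  assoc f g h := by cases f <;> cases g <;> rfl

variable (V)

/-- The free `V-cat`-category on the indexing category. -/
noncomputable instance nEnriched : VCatEnriched V (NIndex V) := freeEnriched V (NIndex V)

/-- The unit `V`-category: one object, with self-distance `1`. -/
def unitVCat : VCat V :=
  letI : VCategory V PUnit.{u + 1} :=
    { vhom := fun _ _ => 1
      one_le_vhom := fun _ => le_rfl
      vhom_mul_vhom_le := fun _ _ _ => (mul_one 1).le }
  ⟨PUnit⟩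

variable {V}

/-- The distances of the two-object `V`-category `2_r`, where `false`, `true` stand for the objects
`0`, `1`. -/
def twoHom (r : V) : Bool → Bool → V
  | false, false => 1
  | true, true => 1
  | false, true => r
  | true, false => ⊥

/-- The `V`-category `2_r`. -/
def twoVCat (r : V) : VCat V :=
  letI : VCategory V (ULift.{u} Bool) :=
    { vhom := fun i j => twoHom r i.down j.down
      one_le_vhom := by rintro ⟨_ | _⟩ <;> exact le_rfl
      vhom_mul_vhom_le := by
        rintro ⟨_ | _⟩ ⟨_ | _⟩ ⟨_ | _⟩ <;> simp [twoHom] }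
  ⟨ULift.{u} Bool⟩

/-- The `V`-functor from the unit `V`-category to `X` which picks the object `x`. -/
def pick (X : VCat V) (x : X) : unitVCat V ⟶ X :=
  (⟨fun _ => x, fun _ _ => VCategory.one_le_vhom x⟩ : VFunctor V _ _)

/-- The values of the weight for `V`-coinserters. -/
def nWeightObj : NIndex V → VCat V
  | .o => unitVCat V
  | .el r => twoVCat r

/-- The action on arrows of the weight for `V`-coinserters: `δ₀ r` and `δ₁ r` are sent to the
`V`-functors from the unit `V`-category that pick the objects `0` and `1` of `2_r`. -/
def nWeightMap : {a b : NIndex V} → NIndex.Hom a b → (nWeightObj b ⟶ nWeightObj a)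
  | _, _, .id a => 𝟙 (nWeightObj a)
  | _, _, .δ₀ r => pick (twoVCat r) (ULift.up false)
  | _, _, .δ₁ r => pick (twoVCat r) (ULift.up true)

theorem nWeightMap_comp {a b c : NIndex V} (q : NIndex.Hom c b) (p : NIndex.Hom b a) :
    nWeightMap (NIndex.Hom.comp q p) = nWeightMap p ≫ nWeightMap q := by
  cases q <;> cases p <;> rfl

variable (V)

/-- The weight for `V`-coinserters, as an ordinary functor. -/
def nWeightOrd : (NIndex V)ᵒᵖ ⥤ VCat V where
  obj a := nWeightObj a.unop
  map p := nWeightMap p.unop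
  map_id _ := rfl
  map_comp p q := nWeightMap_comp q.unop p.unop

/-- The weight `N` for `V`-coinserters. -/
noncomputable def nWeight : VCatFunctor V (NIndex V)ᵒᵖ (VCat V) where
  toFunctor := nWeightOrd V
  vhom_map_le p q := (VCatFunctor.ofFree (V := V) (nWeightOrd V).rightOp).vhom_map_le p.unop q.unop

variable {V}

/-- The set `X_r` of pairs `(x', x)` with `r ≤ X(x', x)`. -/
def PairsAt (X : VCat V) (r : V) : Type u :=
  {p : X × X // r ≤ vhom V p.1 p.2}

/-- The values of `F_X`. -/
def nerveDiagObj (X : VCat V) : NIndex V → Type u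
  | .o => X
  | .el r => PairsAt X r

/-- The action on arrows of `F_X`, by the two projections `X_r → X_o`. -/
def nerveDiagMap (X : VCat V) :
    {a b : NIndex V} → NIndex.Hom a b → nerveDiagObj X a → nerveDiagObj X b
  | _, _, .id _ => fun x => x
  | _, _, .δ₀ _ => fun p => p.1.1
  | _, _, .δ₁ _ => fun p => p.1.2

theorem nerveDiagMap_comp (X : VCat V) {a b c : NIndex V} (p : NIndex.Hom a b)
    (q : NIndex.Hom b c) (x : nerveDiagObj X a) :
    nerveDiagMap X (NIndex.Hom.comp p q) x = nerveDiagMap X q (nerveDiagMap X p x) := by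
  cases p <;> cases q <;> rfl

/-- `F_X` as an ordinary functor. -/
def nerveDiagOrd (X : VCat V) : NIndex V ⥤ Type u where
  obj a := nerveDiagObj X a
  map p := TypeCat.ofHom (nerveDiagMap X p)
  map_id a := rfl
  map_comp p q := by
    ext x
    exact nerveDiagMap_comp X p q x

/-- The `V-cat`-functor `F_X` from the indexing category to `Set`. -/
noncomputable def nerveDiag (X : VCat V) : VCatFunctor V (NIndex V) (Type u) :=
  VCatFunctor.ofFree (nerveDiagOrd X)

/-- The diagram `(N, D F_X)`. -/
noncomputable def coinserterDiagram (X : VCat V) : WeightedDiagram V (VCat V) where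
  L := NIndex V
  weight := nWeight V
  diag := (nerveDiag X).comp (discreteFunctor V)

/-- The `V`-functor `q : D X_o ⟶ X` which is the identity on objects. -/
noncomputable def coinserterMap (X : VCat V) :
    ((nerveDiag X).comp (discreteFunctor V)).obj NIndex.o ⟶ X :=
  (⟨fun x => x, fun x' x => by
    classical
    change (if x' = x then (1 : V) else ⊥) ≤ VCategory.vhom (X := X.carrier) x' x
    by_cases h : x' = x
    · subst h
      rw [if_pos rfl]
      exact VCategory.one_le_vhom (X := X.carrier) x'
    · simp [h]⟩ : VFunctor V ((discreteFunctorOrd V).obj X.carrier) X)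

end Discrete

/-! ### Cocones weighted by `nWeight V`, and a recognition criterion for `V`-coinserters -/

section Coinserters

variable {V : Type u} [CommMonoid V] [CompleteLattice V] [IsQuantale V]
  {C : Type u₂} [Category.{u} C] [VCatEnriched V C]

/-! A cocone weighted by `nWeight V` amounts to one arrow `h` out of `F o` such that, for each `r`,
its composites with `F δ₀` and `F δ₁` have distance at least `r`; distances between cocones are
distances between these arrows (`cocone_ext`, `coconeMk`, `vhom_cocone`). In `V-cat` this yields a
criterion, `isWeightedColimit_of_bijective`: bijectivity on objects plus a witness for every
distance.

The criterion applies to `q : DX_o ⟶ X`, because the pair `(x', x)` lies in `X_r` for `r = X(x',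
x)`. It applies again after `V-cat(DS, -)`: `V`-functors out of `DS` are plain functions, and two of
them at distance `r` form a single function into `X_r`. So these colimits exist and are preserved,
and one colimit step from the discrete objects already reaches every `X`.

Density is checked directly: a transformation `V-cat(D-, X) ⟶ V-cat(D-, Y)` is determined by its
component at a point, where it is a `V`-functor `X ⟶ Y`. -/

/-- The arrow `δ₀ r` of the indexing category of `V`-coinserters. -/
def NIndex.d₀ (r : V) : NIndex.el r ⟶ NIndex.o := NIndex.Hom.δ₀ r

/-- The arrow `δ₁ r` of the indexing category of `V`-coinserters. -/
def NIndex.d₁ (r : V) : NIndex.el r ⟶ NIndex.o := NIndex.Hom.δ₁ r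

/-- The arrow `F o ⟶ Y` underlying a cocone weighted by `nWeight V`. -/
noncomputable def coconeArrow {F : VCatFunctor V (NIndex V) C} {Y : C} (α : nWeight V ⟶ (relHom F).obj Y) :
    F.obj NIndex.o ⟶ Y :=
  VCat.app (NatTrans.app α (op NIndex.o)) PUnit.unit

/-- Naturality at `δ₀`: the object `0` of `2_r` is the image under `N δ₀` of the unique object of
the unit `V`-category. -/
theorem cocone_app_false {F : VCatFunctor V (NIndex V) C} {Y : C}
    (α : nWeight V ⟶ (relHom F).obj Y) (r : V) :
    VFunctor.toFun (NatTrans.app α (op (NIndex.el r))) (ULift.up false) =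
      F.map (NIndex.d₀ r) ≫ coconeArrow α :=
  congrFun (congrArg VFunctor.toFun (NatTrans.naturality α (NIndex.d₀ r).op)) PUnit.unit

theorem cocone_app_true {F : VCatFunctor V (NIndex V) C} {Y : C}
    (α : nWeight V ⟶ (relHom F).obj Y) (r : V) :
    VFunctor.toFun (NatTrans.app α (op (NIndex.el r))) (ULift.up true) =
      F.map (NIndex.d₁ r) ≫ coconeArrow α :=
  congrFun (congrArg VFunctor.toFun (NatTrans.naturality α (NIndex.d₁ r).op)) PUnit.unit

theorem cocone_ext {F : VCatFunctor V (NIndex V) C} {Y : C}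
    {α β : nWeight V ⟶ (relHom F).obj Y} (h : coconeArrow α = coconeArrow β) : α = β := by
  refine NatTrans.ext (funext fun a => VFunctor.ext (funext fun i => ?_))
  rcases a with ⟨_ | r⟩
  · exact h
  · rcases i with ⟨_ | _⟩
    · exact (cocone_app_false α r).trans (h ▸ (cocone_app_false β r).symm)
    · exact (cocone_app_true α r).trans (h ▸ (cocone_app_true β r).symm)

/-- The components at `r` come from the one at `o` by precomposition, which never decreases
distances, so the meet over all components is attained at `o`. -/
theorem vhom_cocone {F : VCatFunctor V (NIndex V) C} {Y : C}
    (α β : nWeight V ⟶ (relHom F).obj Y) :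
    vhom V α β = vhom V (coconeArrow α) (coconeArrow β) := by
  apply le_antisymm
  · exact (iInf_le _ (op NIndex.o)).trans (iInf_le _ PUnit.unit)
  · refine le_iInf fun a => le_iInf fun i => ?_
    rcases a with ⟨_ | r⟩
    · exact le_rfl
    · rcases i with ⟨_ | _⟩
      · have := vhom_comp_left_le (V := V) (F.map (NIndex.d₀ r)) (coconeArrow α) (coconeArrow β)
        rw [← cocone_app_false α r, ← cocone_app_false β r] at this
        exact this
      · have := vhom_comp_left_le (V := V) (F.map (NIndex.d₁ r)) (coconeArrow α) (coconeArrow β)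
        rw [← cocone_app_true α r, ← cocone_app_true β r] at this
        exact this

/-- The component at `r` is a `V`-functor on `2_r`, where the distance from `0` to `1` is `r`. -/
theorem le_vhom_coconeArrow {F : VCatFunctor V (NIndex V) C} {Y : C}
    (α : nWeight V ⟶ (relHom F).obj Y) (r : V) :
    r ≤ vhom V (F.map (NIndex.d₀ r) ≫ coconeArrow α) (F.map (NIndex.d₁ r) ≫ coconeArrow α) := by
  rw [← cocone_app_false, ← cocone_app_true]
  exact VFunctor.vhom_le (NatTrans.app α (op (NIndex.el r))) (ULift.up false) (ULift.up true)

/-- The components of the cocone with a given underlying arrow. -/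
def coconeApp (F : VCatFunctor V (NIndex V) C) {Y : C} (h : F.obj NIndex.o ⟶ Y)
    (hr : ∀ r, r ≤ vhom V (F.map (NIndex.d₀ r) ≫ h) (F.map (NIndex.d₁ r) ≫ h)) :
    (a : NIndex V) → (nWeightObj a ⟶ homObj V (F.obj a) Y)
  | .o => pick (homObj V (F.obj NIndex.o) Y) h
  | .el r =>
    (⟨fun i : ULift.{u} Bool => (bif i.down then F.map (NIndex.d₁ r) ≫ h
        else F.map (NIndex.d₀ r) ≫ h : F.obj (NIndex.el r) ⟶ Y), by
      rintro ⟨_ | _⟩ ⟨_ | _⟩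
      · exact VCategory.one_le_vhom (V := V) (F.map (NIndex.d₀ r) ≫ h)
      · exact hr r
      -- The distance from `1` to `0` in `2_r` is `⊥`, so `hr` is the only condition on `h`.
      · exact bot_le
      · exact VCategory.one_le_vhom (V := V) (F.map (NIndex.d₁ r) ≫ h)⟩ :
      VFunctor V (twoVCat r) (homObj V (F.obj (NIndex.el r)) Y))

/-- The cocone weighted by `nWeight V` with a given underlying arrow. -/
noncomputable def coconeMk (F : VCatFunctor V (NIndex V) C) {Y : C} (h : F.obj NIndex.o ⟶ Y)
    (hr : ∀ r, r ≤ vhom V (F.map (NIndex.d₀ r) ≫ h) (F.map (NIndex.d₁ r) ≫ h)) :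
    nWeight V ⟶ (relHom F).obj Y where
  app a := coconeApp F h hr a.unop
  naturality := by
    rintro ⟨a⟩ ⟨b⟩ ⟨p⟩
    change NIndex.Hom b a at p
    cases p with
    | id =>
      exact ((congrArg (· ≫ _) ((nWeight V).map_id (op a))).trans (Category.id_comp _)).trans
        ((congrArg (coconeApp F h hr a ≫ ·) ((relHomObj F Y).map_id (op a))).trans
          (Category.comp_id _)).symm
    | δ₀ r => rfl
    | δ₁ r => rfl

/-- A cocone of `V`-categories is a `V`-coinserter if its underlying `V`-functor is bijective on
objects and every distance `r` in its vertex is that of a pair of objects coming from `F r`. -/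
theorem isWeightedColimit_of_bijective {F : VCatFunctor V (NIndex V) (VCat V)} {X : VCat V}
    (μ : nWeight V ⟶ (relHom F).obj X)
    (hbij : Function.Bijective (VCat.app (coconeArrow μ)))
    (hpair : ∀ x' x : X, ∃ p : F.obj (NIndex.el (vhom V x' x)),
      VCat.app (F.map (NIndex.d₀ _) ≫ coconeArrow μ) p = x' ∧
      VCat.app (F.map (NIndex.d₁ _) ≫ coconeArrow μ) p = x) :
    IsWeightedColimit (nWeight V) F μ := by
  intro Y
  refine ⟨⟨fun g g' h => ?_, fun β => ?_⟩, fun g g' => ?_⟩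
  · have h' : coconeArrow μ ≫ g = coconeArrow μ ≫ g' :=
      congrArg (fun α : nWeight V ⟶ (relHom F).obj Y => coconeArrow α) h
    refine VFunctor.ext (funext fun x => ?_)
    obtain ⟨y, rfl⟩ := hbij.2 x
    exact congrFun (congrArg VFunctor.toFun h') y
  · let e := Equiv.ofBijective _ hbij
    have he : ∀ y, e.symm (VCat.app (coconeArrow μ) y) = y := e.symm_apply_apply
    -- The factorization is forced on objects. For `V`-functoriality, take `r = X(x', x)` and a
    -- witness `p` in `F r`: the cocone inequality for `β` bounds `r` by a meet over `F r`, and its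
    -- term at `p` is the required distance.
    let g : X ⟶ Y := (⟨fun x => VCat.app (coconeArrow β) (e.symm x), fun x' x => by
      obtain ⟨p, hp', hp⟩ := hpair x' x
      have h₀ : e.symm x' = VCat.app (F.map (NIndex.d₀ _)) p :=
        (congrArg e.symm hp'.symm).trans (he _)
      have h₁ : e.symm x = VCat.app (F.map (NIndex.d₁ _)) p :=
        (congrArg e.symm hp.symm).trans (he _)
      rw [h₀, h₁]
      exact (le_vhom_coconeArrow β (vhom V x' x)).trans (iInf_le _ p)⟩ : VFunctor V X Y)
    refine ⟨g, cocone_ext (VFunctor.ext (funext fun y => ?_))⟩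
    exact congrArg (VCat.app (coconeArrow β)) (he y)
  · refine (vhom_cocone (μ ≫ (relHom F).map g) (μ ≫ (relHom F).map g')).trans ?_
    -- The meet over objects of `F o` is a meet over objects of `X`, reindexed along a surjection.
    exact hbij.2.iInf_comp (fun x => vhom V (VFunctor.toFun g x) (VFunctor.toFun g' x))

end Coinserters

/-! ### Uniqueness of weighted colimits and independence of preservation from the choice -/

section Transport

variable {V : Type u} [CommMonoid V] [CompleteLattice V] [IsQuantale V]
  {A : Type u₁} [Category.{v₁} A] [VCatEnriched V A]
  {C : Type u₂} [Category.{u} C] [VCatEnriched V C]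
  {B : Type u₃} [Category.{u} B] [VCatEnriched V B]

theorem vhom_iso_comp {X Y Z : C} (i : X ≅ Y) (g g' : Y ⟶ Z) :
    vhom V (i.hom ≫ g) (i.hom ≫ g') = vhom V g g' := by
  refine le_antisymm ?_ (vhom_comp_left_le _ _ _)
  simpa using vhom_comp_left_le (V := V) i.inv (i.hom ≫ g) (i.hom ≫ g')

theorem IsWeightedColimit.comp_iso {W : VCatFunctor V Aᵒᵖ (VCat V)} {F : VCatFunctor V A C}
    {X Y : C} {μ : W ⟶ (relHom F).obj X} (hμ : IsWeightedColimit W F μ) (i : X ≅ Y) :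
    IsWeightedColimit W F (μ ≫ (relHom F).map i.hom) := by
  intro Z
  have key : (fun g : Y ⟶ Z => (μ ≫ (relHom F).map i.hom) ≫ (relHom F).map g) =
      (fun g : X ⟶ Z => μ ≫ (relHom F).map g) ∘ fun g => i.hom ≫ g := by
    funext g
    simp
  rw [key]
  refine ⟨(hμ Z).1.comp ⟨fun g g' h => (cancel_epi i.hom).1 h, fun g => ⟨i.inv ≫ g, by simp⟩⟩,
    fun g g' => ?_⟩
  exact ((hμ Z).2 _ _).trans (vhom_iso_comp i g g')

/-- A density presentation asks for preservation of every colimit cocone of a diagram; this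
comparison reduces that to one chosen cocone. -/
theorem IsWeightedColimit.exists_iso {W : VCatFunctor V Aᵒᵖ (VCat V)} {F : VCatFunctor V A C}
    {X Y : C} {μ : W ⟶ (relHom F).obj X} (hμ : IsWeightedColimit W F μ)
    {ν : W ⟶ (relHom F).obj Y} (hν : IsWeightedColimit W F ν) :
    ∃ i : X ≅ Y, μ ≫ (relHom F).map i.hom = ν := by
  obtain ⟨f, hf⟩ := (hμ Y).1.2 ν
  obtain ⟨g, hg⟩ := (hν X).1.2 μ
  dsimp only at hf hg
  refine ⟨⟨f, g, (hμ X).1.1 ?_, (hν Y).1.1 ?_⟩, hf⟩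
  · dsimp only
    rw [Functor.map_comp, ← Category.assoc, hf, hg, CategoryTheory.Functor.map_id, Category.comp_id]
  · dsimp only
    rw [Functor.map_comp, ← Category.assoc, hg, hf, CategoryTheory.Functor.map_id, Category.comp_id]

theorem relHom_map_comp_relHomMap (F : VCatFunctor V A C) (G : VCatFunctor V C B) {X Y : C}
    (f : X ⟶ Y) :
    (relHom F).map f ≫ relHomMap F G Y = relHomMap F G X ≫ (relHom (F.comp G)).map (G.map f) :=
  NatTrans.ext (funext fun _ => VFunctor.ext (funext fun _ => G.map_comp _ f))

/-- Whether a `V-cat`-functor preserves a colimit does not depend on the choice of the colimit. -/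
theorem PreservesWeightedColimit.of_isWeightedColimit {W : VCatFunctor V Aᵒᵖ (VCat V)}
    {F : VCatFunctor V A C} {G : VCatFunctor V C B} {X Y : C} {μ : W ⟶ (relHom F).obj X}
    (h : PreservesWeightedColimit W F μ G) (hμ : IsWeightedColimit W F μ)
    {ν : W ⟶ (relHom F).obj Y} (hν : IsWeightedColimit W F ν) :
    PreservesWeightedColimit W F ν G := by
  obtain ⟨i, rfl⟩ := hμ.exists_iso hν
  have := IsWeightedColimit.comp_iso h (G.mapIso i)
  unfold PreservesWeightedColimit
  -- Naturality of `relHomMap` turns the comparison isomorphism `i` into `G i`, acting on the cocone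
  -- already known to be a colimit.
  rw [Category.assoc, relHom_map_comp_relHomMap, ← Category.assoc]
  exact this

end Transport

/-! ### Density of `D`, full faithfulness, and the density presentation -/

section Discrete

variable {V : Type u} [CommMonoid V] [CompleteLattice V] [IsQuantale V]

/-- The `V`-functor out of a discrete `V`-category given by a function. -/
noncomputable def discreteLift {S : Type u} {X : VCat V} (f : S → X) :
    (discreteFunctor V).obj S ⟶ X :=
  (⟨f, fun s' s => by
    classical
    change (if s' = s then (1 : V) else ⊥) ≤ vhom V (f s') (f s)
    split_ifs with h
    · subst h
      exact VCategory.one_le_vhom (V := V) (f s')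
    · exact bot_le⟩ : VFunctor V ((discreteFunctor V).obj S) X)

/-- A transformation `V-cat(D-, X) ⟶ V-cat(D-, Y)` is composition with its component at a point. -/
theorem relHom_discrete_app {X Y : VCat V}
    (α : (relHom (discreteFunctor V)).obj X ⟶ (relHom (discreteFunctor V)).obj Y)
    {S : Type u} (f : (discreteFunctor V).obj S ⟶ X) (s : S) :
    VFunctor.toFun (VCat.app (NatTrans.app α (op S)) f) s =
      VFunctor.toFun (VCat.app (NatTrans.app α (op PUnit.{u + 1}))
        (discreteLift fun _ => VFunctor.toFun f s)) PUnit.unit := by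
  -- Naturality at the function from the point to `S` picking `s`.
  have h := congrFun (congrArg VFunctor.toFun
    (NatTrans.naturality α (TypeCat.ofHom (fun _ : PUnit.{u + 1} => s)).op)) f
  exact (congrFun (congrArg VFunctor.toFun h) PUnit.unit).symm

theorem isDense_discreteFunctor : IsDense (discreteFunctor V) := by
  intro X Y
  refine ⟨⟨fun g g' h => VFunctor.ext (funext fun x => ?_), fun α => ?_⟩, fun g g' => ?_⟩
  · exact congrArg (fun α : (relHom (discreteFunctor V)).obj X ⟶
      (relHom (discreteFunctor V)).obj Y => VFunctor.toFun (VCat.app (NatTrans.app α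
        (op PUnit.{u + 1})) (discreteLift fun _ => x)) PUnit.unit) h
  · let g : X ⟶ Y := (⟨fun x => VFunctor.toFun (VCat.app (NatTrans.app α (op PUnit.{u + 1}))
        (discreteLift fun _ => x)) PUnit.unit, fun x' x => by
      -- Distances between `V`-functors out of the one-point discrete `V`-category are meets with a
      -- single term, so `V`-functoriality of the component of `α` at the point is that of `g`.
      refine le_trans (le_iInf fun _ => le_rfl) ((VFunctor.vhom_le
        (NatTrans.app α (op PUnit.{u + 1})) (discreteLift fun _ => x')
          (discreteLift fun _ => x)).trans (iInf_le _ PUnit.unit))⟩ : VFunctor V X Y)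
    refine ⟨g, NatTrans.ext (funext fun S => VFunctor.ext (funext fun f =>
      VFunctor.ext (funext fun s => ?_)))⟩
    exact (relHom_discrete_app α f s).symm
  · refine le_antisymm (le_iInf fun x => ?_) ((relHom (discreteFunctor V)).vhom_map_le g g')
    -- Testing at the one-point set and the `V`-functor picking `x` recovers the distance at `x`.
    exact (iInf_le _ (op PUnit.{u + 1})).trans
      ((iInf_le _ (discreteLift fun _ => x)).trans (iInf_le _ PUnit.unit))

theorem fullyFaithful_discreteFunctor (integral : (1 : V) = ⊤) :
    (discreteFunctor V).FullyFaithful := by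
  classical
  intro S T
  refine ⟨⟨fun f g h => ?_, fun f => ⟨TypeCat.ofHom (VCat.app f), rfl⟩⟩, fun f g => ?_⟩
  · ext s
    exact congrFun (congrArg VFunctor.toFun h) s
  · refine le_antisymm ?_ ((discreteFunctor V).vhom_map_le f g)
    change (⨅ s : S, if f s = g s then (1 : V) else ⊥) ≤ if f = g then (1 : V) else ⊥
    split_ifs with h
    -- Integrality matters when `S` is empty: the meet is then `⊤`, while the discrete self-distance
    -- is `1`.
    · exact integral ▸ le_top
    · obtain ⟨s, hs⟩ : ∃ s, f s ≠ g s := by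
        by_contra! hc
        exact h (by ext s; exact hc s)
      exact (iInf_le _ s).trans (if_neg hs).le

/-- The cocone exhibiting `X` as a `V`-coinserter of discrete `V`-categories. -/
noncomputable def nerveCocone (X : VCat V) :
    nWeight V ⟶ (relHom ((nerveDiag X).comp (discreteFunctor V))).obj X :=
  -- The distance of the two projections to `X` is a meet over `X_r`, each term of which is at least
  -- `r` by definition of `X_r`.
  coconeMk _ (coinserterMap X) fun _ => le_iInf fun p : PairsAt X _ => p.2

theorem isWeightedColimit_nerveCocone (X : VCat V) :
    IsWeightedColimit (nWeight V) ((nerveDiag X).comp (discreteFunctor V)) (nerveCocone X) :=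
  isWeightedColimit_of_bijective _ Function.bijective_id
    fun x' x => ⟨(⟨(x', x), le_rfl⟩ : PairsAt X _), rfl, rfl⟩

/-- The recognition criterion applies once more, since functions out of a discrete `V`-category lift
freely along `q` and into `X_r`. -/
theorem preservesWeightedColimit_nerveCocone (X : VCat V) (S : Type u) :
    PreservesWeightedColimit (nWeight V) ((nerveDiag X).comp (discreteFunctor V)) (nerveCocone X)
      (covariantHom V ((discreteFunctor V).obj S)) := by
  refine isWeightedColimit_of_bijective _ ⟨fun f g h => ?_, fun f => ?_⟩ fun f' f => ?_
  · exact VFunctor.ext (congrArg (VCat.app (X := (discreteFunctor V).obj S) (Y := X)) h)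
  · exact ⟨discreteLift (X := (discreteFunctor V).obj X.carrier)
      (VCat.app (X := (discreteFunctor V).obj S) (Y := X) f), rfl⟩
  -- Here `r` is the distance of `f'` and `f`, a meet over `S`, so every pair `(f' s, f s)` lies in
  -- `X_r`.
  · exact ⟨discreteLift (X := (discreteFunctor V).obj (PairsAt X _))
      fun s => ⟨(VCat.app (X := (discreteFunctor V).obj S) (Y := X) f' s,
        VCat.app (X := (discreteFunctor V).obj S) (Y := X) f s), iInf_le _ s⟩, rfl, rfl⟩

theorem isDensityPresentation_coinserterDiagram (integral : (1 : V) = ⊤) :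
    IsDensityPresentation (discreteFunctor V) (fun X : VCat V => coinserterDiagram X) where
  fullyFaithful := fullyFaithful_discreteFunctor integral
  exists_colimit X := ⟨X, nerveCocone X, isWeightedColimit_nerveCocone X⟩
  preserves X _ _ hμ S := (preservesWeightedColimit_nerveCocone X S).of_isWeightedColimit
    (isWeightedColimit_nerveCocone X) hμ
  closure X := .colim X (nerveCocone X) (isWeightedColimit_nerveCocone X)
    fun l => .of ((nerveDiag X).obj l)

end Discrete

theorem theorem3p15 (V : Type u) [CommMonoid V] [CompleteLattice V] [IsQuantale V]
    [Nontrivial V] (integral : (1 : V) = ⊤) :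
    IsDense (discreteFunctor V) ∧
    IsDensityPresentation (discreteFunctor V) (fun X : VCat V => coinserterDiagram X) ∧
    ∀ X : VCat V, ∃ μ : nWeight V ⟶ (relHom ((nerveDiag X).comp (discreteFunctor V))).obj X,
      IsWeightedColimit (nWeight V) ((nerveDiag X).comp (discreteFunctor V)) μ ∧
      VCat.app (NatTrans.app μ (op NIndex.o)) PUnit.unit = coinserterMap X := by
  exact ⟨isDense_discreteFunctor, isDensityPresentation_coinserterDiagram integral,
    fun X => ⟨nerveCocone X, isWeightedColimit_nerveCocone X, rfl⟩⟩
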